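/- Consider a sequence of single-class G/M/N queues indexed by $n$. Let $\{IA(l)\}_{l\ge1}$ be i.i.d. positive random variables with mean $1$ and finite variance, let $S$ be a standard Poisson process independent of them, and let $\lambda^n,\mu^n>0$ and $N^n\in\{1,2,\dots\}$. The arrival process is $A^n(t)=\sup\{l\ge 0:\sum_{k=1}^{l} IA(k)/\lambda^n\le t\}$, and the number of customers in the system $X^n$ is an RCLL, $\{0,1,2,\dots\}$-valued process with deterministic $X^n(0)$ that satisfies, for all $t\ge0$, $$X^n(t)=X^n(0)+A^n(t)-S\Big(\mu^n\int_0^t \big(X^n(s)\wedge N^n\big)\,ds\Big).$$ Let $b_n\to\infty$ with $b_n/\sqrt n\to0$, and assume that, as $n\to\infty$, $$\frac{\lambda^n}{n}\to\lambda\in(0,\infty),\qquad \frac{N^n\mu^n}{n}\to\mu\in(0,\infty),\qquad \frac{\sqrt n}{b_n}\Big(\frac{\lambda^n}{n}-\frac{N^n\mu^n}{n}\Big)\to r\in\mathbb R .$$ Define $$\tilde A^n(t)=\frac{A^n(t)-\lambda^n t}{b_n\sqrt n},\qquad \tilde S^n_\mu(t)=\frac{S(N^n\mu^n t)-N^n\mu^n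 t}{b_n\sqrt n},\qquad \tilde X^n(t)=\frac{X^n(t)-N^n}{b_n\sqrt n}.$$ Fix $T>0$. Path spaces $D([0,T],\mathbb R^k)$ carry the Skorohod $J_1$ topology, and a rate function is a $[0,\infty]$-valued function with compact sublevel sets $\{\cdot\le a\}$, $0\le a<\infty$. Assume that - $(\tilde A^n,\tilde S^n_\mu)$ satisfies a large deviation principle (LDP) in $D([0,T],\mathbb R^2)$ with speed $b_n^2$ and a rate function $\mathbb I$ that equals $\infty$ on discontinuous paths; - $N^n=o(n)$, and $\tilde X^n(0)\to x$ with $x\ge0$. Then $\{\tilde X^n\}$ satisfies an LDP in $D([0,T],\mathbb R)$ with speed $b_n^2$ and rate function $$\bar{\mathbb I}_X(\psi)=\inf\big\{\mathbb I(\psi^1,\psi^2):\ \psi=\Gamma(x+r\mathbf e+\psi^1-\psi^2)\big\},\qquad \mathbf e(t)=t,\quad \inf\emptyset=\infty .$$ Here $\Gamma$ is the one-dimensional Skorohod reflection map: for $\psi\in D([0,T],\mathbb R)$ with $\psi(0)\ge0$, $\Gamma(\psi)=\phi^1$, where $(\phi^1,\phi^2)$ is the unique pair with $\phi^1(0)=\psi(0)$,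 $\phi^1=\psi+\phi^2\ge0$, $\phi^2$ nondecreasing, and $\int_{[0,T]}\phi^1\,d\phi^2=0$. -/

import Mathlib

open Set Filter Topology MeasureTheory ProbabilityTheory
open scoped NNReal ENNReal

/-- Right-continuous with left limits. (At a least index the left-limit condition is void,
since `𝓝[<] t = ⊥` there.) -/
def IsRCLL {ι E : Type*} [TopologicalSpace ι] [Preorder ι] [TopologicalSpace E]
    (f : ι → E) : Prop :=
  ∀ t, ContinuousWithinAt f (Ici t) t ∧ ∃ l, Tendsto f (𝓝[<] t) (𝓝 l)

/-- The space `D([0,T], E)` of RCLL paths. -/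
structure DPath (T : ℝ) (E : Type*) [TopologicalSpace E] where
  toFun : Icc (0 : ℝ) T → E
  rcll : IsRCLL toFun

namespace DPath

instance {T : ℝ} {E : Type*} [TopologicalSpace E] :
    CoeFun (DPath T E) (fun _ => Icc (0 : ℝ) T → E) := ⟨DPath.toFun⟩

/-- Time changes: strictly increasing (hence continuous) maps of `[0,T]` onto itself. -/
abbrev TimeChange (T : ℝ) : Type := Icc (0 : ℝ) T ≃o Icc (0 : ℝ) T

/-- `‖f‖° = sup_{s<t} |log ((f t - f s)/(t - s))|`, with values in `[0,∞]`. -/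
noncomputable def logNorm {T : ℝ} (f : TimeChange T) : ℝ≥0∞ :=
  ⨆ (s : Icc (0 : ℝ) T) (t : Icc (0 : ℝ) T) (_ : s < t),
    ENNReal.ofReal |Real.log (((f t : ℝ) - (f s : ℝ)) / ((t : ℝ) - (s : ℝ)))|

/-- The `J₁` distance `inf_f max (‖f‖°, sup_t ‖φ t - φ' (f t)‖)`. -/
noncomputable def j1Dist {T : ℝ} {E : Type*} [PseudoEMetricSpace E] (φ φ' : DPath T E) : ℝ≥0∞ :=
  ⨅ f : TimeChange T, max (logNorm f) (⨆ t, edist (φ t) (φ' (f t)))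

theorem le_logNorm {T : ℝ} (f : TimeChange T) {s t : Icc (0 : ℝ) T} (h : s < t) :
    ENNReal.ofReal |Real.log (((f t : ℝ) - (f s : ℝ)) / ((t : ℝ) - (s : ℝ)))| ≤ logNorm f :=
  le_iSup_of_le s (le_iSup_of_le t (le_iSup_of_le h le_rfl))

theorem logNorm_refl (T : ℝ) : logNorm (OrderIso.refl (Icc (0 : ℝ) T)) = 0 := by
  simp only [logNorm, ENNReal.iSup_eq_zero]
  intro s t h
  have h' : (t : ℝ) - (s : ℝ) ≠ 0 := (sub_pos.2 (Subtype.coe_lt_coe.2 h)).ne'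
  simp [div_self h']

theorem logNorm_symm_le {T : ℝ} (f : TimeChange T) : logNorm f.symm ≤ logNorm f := by
  refine iSup_le fun s => iSup_le fun t => iSup_le fun h => ?_
  have h1 := le_logNorm f (f.symm.strictMono h)
  simp only [OrderIso.apply_symm_apply] at h1
  refine le_trans (le_of_eq ?_) h1
  rw [← inv_div, Real.log_inv, abs_neg]

theorem logNorm_trans_le {T : ℝ} (f g : TimeChange T) :
    logNorm (f.trans g) ≤ logNorm f + logNorm g := by
  refine iSup_le fun s => iSup_le fun t => iSup_le fun h => ?_
  have hf : f s < f t := f.strictMono h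
  have hg : g (f s) < g (f t) := g.strictMono hf
  have p1 : (0 : ℝ) < (t : ℝ) - s := sub_pos.2 (Subtype.coe_lt_coe.2 h)
  have p2 : (0 : ℝ) < (f t : ℝ) - f s := sub_pos.2 (Subtype.coe_lt_coe.2 hf)
  have p3 : (0 : ℝ) < (g (f t) : ℝ) - g (f s) := sub_pos.2 (Subtype.coe_lt_coe.2 hg)
  have e : (((f.trans g) t : ℝ) - ((f.trans g) s : ℝ)) / ((t : ℝ) - s)
      = (((f t : ℝ) - f s) / ((t : ℝ) - s)) * (((g (f t) : ℝ) - g (f s)) / ((f t : ℝ) - f s)) := by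
    simp only [OrderIso.trans_apply]
    field_simp
  rw [e, Real.log_mul (div_pos p2 p1).ne' (div_pos p3 p2).ne']
  calc _ ≤ ENNReal.ofReal (|Real.log (((f t : ℝ) - f s) / ((t : ℝ) - s))|
          + |Real.log (((g (f t) : ℝ) - g (f s)) / ((f t : ℝ) - f s))|) :=
        ENNReal.ofReal_le_ofReal (abs_add_le _ _)
    _ ≤ _ := ENNReal.ofReal_add_le
    _ ≤ _ := add_le_add (le_logNorm f h) (le_logNorm g hf)

theorem j1Dist_self {T : ℝ} {E : Type*} [PseudoEMetricSpace E] (φ : DPath T E) :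
    j1Dist φ φ = 0 := by
  refine le_antisymm (iInf_le_of_le (OrderIso.refl _) ?_) bot_le
  simp [logNorm_refl]

theorem j1Dist_comm_le {T : ℝ} {E : Type*} [PseudoEMetricSpace E] (φ φ' : DPath T E) :
    j1Dist φ φ' ≤ j1Dist φ' φ := by
  refine le_iInf fun f => iInf_le_of_le f.symm (max_le_max (logNorm_symm_le f) ?_)
  refine iSup_le fun t => le_iSup_of_le (f.symm t) ?_
  rw [OrderIso.apply_symm_apply, edist_comm]

theorem j1Dist_triangle {T : ℝ} {E : Type*} [PseudoEMetricSpace E] (φ φ' φ'' : DPath T E) :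
    j1Dist φ φ'' ≤ j1Dist φ φ' + j1Dist φ' φ'' := by
  unfold j1Dist
  rw [ENNReal.iInf_add]
  refine le_iInf fun f => ?_
  rw [ENNReal.add_iInf]
  refine le_iInf fun g => ?_
  refine iInf_le_of_le (f.trans g) (max_le ?_ ?_)
  · exact (logNorm_trans_le f g).trans (add_le_add (le_max_left _ _) (le_max_left _ _))
  · refine iSup_le fun t => (edist_triangle _ (φ' (f t)) _).trans (add_le_add ?_ ?_)
    · exact le_trans (le_iSup (fun t => edist (φ t) (φ' (f t))) t) (le_max_right _ _)
    · exact le_trans (le_iSup (fun t => edist (φ' t) (φ'' (g t))) (f t)) (le_max_right _ _)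

/-- `D([0,T], E)` carries the Skorohod `J₁` topology. -/
noncomputable instance {T : ℝ} {E : Type*} [PseudoEMetricSpace E] :
    PseudoEMetricSpace (DPath T E) where
  edist := j1Dist
  edist_self := j1Dist_self
  edist_comm φ φ' := le_antisymm (j1Dist_comm_le φ φ') (j1Dist_comm_le φ' φ)
  edist_triangle := j1Dist_triangle

end DPath

/-- A rate function: `[0,∞]`-valued with compact sublevel sets. -/
def IsRateFunction {S : Type*} [TopologicalSpace S] (I : S → ℝ≥0∞) : Prop :=
  ∀ a : ℝ≥0, IsCompact {x | I x ≤ a}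

/-- The random elements `Y n` satisfy the large deviation principle with parameter (speed)
`a n → ∞` and rate function `I`. -/
structure SatisfiesLDP {Ω S : Type*} [MeasurableSpace Ω] [TopologicalSpace S]
    (P : Measure Ω) (Y : ℕ → Ω → S) (a : ℕ → ℝ) (I : S → ℝ≥0∞) : Prop where
  speed : Tendsto a atTop atTop
  rate : IsRateFunction I
  upper : ∀ F : Set S, IsClosed F →
    limsup (fun n => ((1 / a n : ℝ) : EReal) * ENNReal.log (P {ω | Y n ω ∈ F})) atTop
      ≤ -((⨅ x ∈ F, I x : ℝ≥0∞) : EReal)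
  lower : ∀ G : Set S, IsOpen G →
    -((⨅ x ∈ G, I x : ℝ≥0∞) : EReal)
      ≤ liminf (fun n => ((1 / a n : ℝ) : EReal) * ENNReal.log (P {ω | Y n ω ∈ G})) atTop

/-- `(φ₁, φ₂)` solves the Skorohod problem on `[0,T]` for the data `ψ`. The complementarity
condition `∫ φ₁ dφ₂ = 0` is a Lebesgue-Stieltjes integral with respect to the distribution
function obtained by extending `φ₂` as a constant to the left of `0` and to the right of `T`. -/
structure SolvesSkorohodProblem {T : ℝ} (hT : 0 ≤ T) (ψ φ₁ φ₂ : Icc (0 : ℝ) T → ℝ) :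
    Prop where
  initial : ψ ⟨0, left_mem_Icc.2 hT⟩ = φ₁ ⟨0, left_mem_Icc.2 hT⟩
  decomp : ∀ t, φ₁ t = ψ t + φ₂ t
  nonneg : ∀ t, 0 ≤ φ₁ t
  mono : Monotone φ₂
  compl : ∃ m : StieltjesFunction ℝ, (∀ t, m t = IccExtend hT φ₂ t) ∧
    ∫⁻ t, ENNReal.ofReal (IccExtend hT φ₁ t) ∂m.measure = 0

/-- `φ = Γ(ψ)`, where `Γ` is the one-dimensional Skorohod map on `[0,T]`. -/
def IsSkorohodMap {T : ℝ} (hT : 0 ≤ T) (ψ φ : Icc (0 : ℝ) T → ℝ) : Prop :=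
  ∃ φ₂ : Icc (0 : ℝ) T → ℝ, SolvesSkorohodProblem hT ψ φ φ₂

/-- The unscaled inter-arrival times: i.i.d., positive, of mean one and finite variance. -/
structure IsInterarrivalSequence {Ω : Type*} [MeasurableSpace Ω] (P : Measure Ω)
    (IA : ℕ → Ω → ℝ) : Prop where
  measurable : ∀ k, Measurable (IA k)
  indep : iIndepFun IA P
  ident : ∀ k, IdentDistrib (IA k) (IA 0) P P
  pos : ∀ k, ∀ᵐ ω ∂P, 0 < IA k ω
  memLp_two : MemLp (IA 0) 2 P
  mean_one : ∫ ω, IA 0 ω ∂P = 1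

/-- The number of arrivals up to time `t` when the arrival rate is `lam`
(almost surely, the set below is finite for every `t`). -/
noncomputable def arrivalCount {Ω : Type*} (IA : ℕ → Ω → ℝ) (lam : ℝ) (ω : Ω) (t : ℝ) : ℕ :=
  sSup {l : ℕ | ∑ k ∈ Finset.range l, IA k ω / lam ≤ t}

/-- A standard (unit rate) Poisson process. -/
structure IsStandardPoissonProcess {Ω : Type*} [MeasurableSpace Ω] (P : Measure Ω)
    (S : ℝ≥0 → Ω → ℕ) : Prop where
  measurable : ∀ t, Measurable (S t)
  zero : ∀ᵐ ω ∂P, S 0 ω = 0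
  mono : ∀ᵐ ω ∂P, Monotone (fun t => S t ω)
  rcll : ∀ᵐ ω ∂P, IsRCLL (fun t => S t ω)
  indep : HasIndepIncrements S P
  law : ∀ s t : ℝ≥0, s ≤ t → HasLaw (fun ω => S t ω - S s ω) (poissonMeasure (t - s)) P

/-- `X` is the customers-in-system process of a single-class G/M/N queue with arrival rate `lam`,
individual service rate `mu`, `N` servers and deterministic initial state `x₀`, under the
non-idling policy: the number of customers in service is `min X N`, and service completions are
`S (mu * ∫₀ᵗ min X N)`. -/
structure IsCustomersInSystem {Ω : Type*} [MeasurableSpace Ω] (P : Measure Ω)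
    (IA : ℕ → Ω → ℝ) (S : ℝ≥0 → Ω → ℕ) (lam mu : ℝ) (N x₀ : ℕ) (X : ℝ≥0 → Ω → ℕ) : Prop where
  measurable : ∀ t, Measurable (X t)
  rcll : ∀ᵐ ω ∂P, IsRCLL (fun t => X t ω)
  dynamics : ∀ᵐ ω ∂P, ∀ t : ℝ≥0,
    (X t ω : ℝ) = (x₀ : ℝ) + (arrivalCount IA lam ω t : ℝ)
      - (S (Real.toNNReal
          (mu * ∫ s in (0 : ℝ)..t, ((min (X s.toNNReal ω) N : ℕ) : ℝ))) ω : ℝ)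

/-- `(b √n)⁻¹ (A(t) - lam t)`. -/
noncomputable def scaledArrival {Ω : Type*} (IA : ℕ → Ω → ℝ) (lam b : ℝ) (n : ℕ)
    (ω : Ω) (t : ℝ) : ℝ :=
  1 / (b * √(n : ℝ)) * ((arrivalCount IA lam ω t : ℝ) - lam * t)

/-- `(b √n)⁻¹ (S(N mu t) - N mu t)`. -/
noncomputable def scaledService {Ω : Type*} (S : ℝ≥0 → Ω → ℕ) (mu b : ℝ) (N n : ℕ)
    (ω : Ω) (t : ℝ) : ℝ :=
  1 / (b * √(n : ℝ)) * ((S (Real.toNNReal (N * mu * t)) ω : ℝ) - N * mu * t)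

/-- `(b √n)⁻¹ (X(t) - N)`. -/
noncomputable def scaledCustomers {Ω : Type*} (X : ℝ≥0 → Ω → ℕ) (b : ℝ) (N n : ℕ)
    (ω : Ω) (t : ℝ) : ℝ :=
  1 / (b * √(n : ℝ)) * ((X t.toNNReal ω : ℝ) - N)

/-! Put c = b_n √n and y = (X - N)/c. Since min(X, N) = N - c y⁻, the dynamics become y = h + L with
L = μⁿ ∫ y⁻. Here h is the scaled initial state plus a drift close to r t plus the scaled arrivals
minus the scaled service noise read at τ(t) = t - κ L(t), where κ = c/(N μⁿ) → 0. So y is kept up by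
a penalty instead of a reflection, and N = o(n) with N μⁿ/n → μ > 0 makes the penalty rate μⁿ tend
to infinity.

Two estimates carry the limit. The penalty L grows only while y < 0, so it never exceeds the running
supremum of h⁻ (`penalty_le`); this bound does not depend on τ, so the delay κ L vanishes. Also, if
y were clearly negative at some time, it would have been so during a whole interval before it, by
equicontinuity of the inputs; L would then have grown by a multiple of μⁿ, against its bound. Hence
y is asymptotically nonnegative, and L approaches the running supremum of h⁻, which is the Skorohod
regulator.

This is a deterministic statement about convergent inputs, and a contraction principle for relations
turns it into the LDP. The rate is finite only at continuous paths, where J₁ convergence is uniform,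
so all estimates are in the sup norm. -/

/-! ### Contraction principle for converging relations -/

/-- The contraction principle for random elements `Z n` tied to `Y n` by relations `R n` that
converge, along convergent sequences, to a limit relation `G`. -/
theorem SatisfiesLDP.of_relation {Ω S S' : Type*} [MeasurableSpace Ω] [PseudoEMetricSpace S]
    [PseudoEMetricSpace S'] {P : Measure Ω} {Y : ℕ → Ω → S} {Z : ℕ → Ω → S'} {a : ℕ → ℝ}
    {I : S → ℝ≥0∞} (h : SatisfiesLDP P Y a I) (R : ℕ → S → S' → Prop) (G : S → S' → Prop)
    (hR : ∀ᶠ n in atTop, ∀ᵐ ω ∂P, R n (Y n ω) (Z n ω))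
    (hRG : ∀ (m : ℕ → ℕ) (u : ℕ → S) (v : ℕ → S') (φ : S), Tendsto m atTop atTop →
      (∀ j, R (m j) (u j) (v j)) → Tendsto u atTop (𝓝 φ) → I φ ≠ ⊤ →
      (∃ ψ, G φ ψ) ∧ ∀ ψ, G φ ψ → Tendsto v atTop (𝓝 ψ))
    (hG : ∀ (u : ℕ → S) (v : ℕ → S') (φ : S), (∀ j, G (u j) (v j)) →
      Tendsto u atTop (𝓝 φ) → I φ ≠ ⊤ → ∃ ψ, G φ ψ ∧ Tendsto v atTop (𝓝 ψ))
    (hsep : ∀ φ φ' : S, I φ ≠ ⊤ → I φ' ≠ ⊤ → Inseparable φ φ' → φ = φ') :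
    SatisfiesLDP P Z a (fun ψ => ⨅ (φ : S) (_ : G φ ψ), I φ) := by
  have hcoef : ∀ᶠ n in atTop, (0 : EReal) ≤ ((1 / a n : ℝ) : EReal) := by
    filter_upwards [h.speed.eventually_ge_atTop 0] with n hn
    exact_mod_cast one_div_nonneg.2 hn
  refine ⟨h.speed, fun c => ?_, fun F hF => ?_, fun O hO => ?_⟩
  · refine IsSeqCompact.isCompact fun v hv => ?_
    -- The infimum over preimages need not be known to be attained, so near-minimizers are used and
    -- the excess 1/(j+1) is removed in the limit.
    have hex : ∀ j : ℕ, ∃ φ, G φ (v j) ∧ I φ < c + ((1 / ((j : ℝ≥0) + 1) : ℝ≥0) : ℝ≥0∞) := by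
      intro j
      have : (⨅ (φ : S) (_ : G φ (v j)), I φ) < c + ((1 / ((j : ℝ≥0) + 1) : ℝ≥0) : ℝ≥0∞) := by
        refine lt_of_le_of_lt (hv j) ?_
        have : c < c + 1 / ((j : ℝ≥0) + 1) := lt_add_of_pos_right _ (by positivity)
        exact_mod_cast this
      simp only [iInf_lt_iff] at this
      obtain ⟨φ, h1, h2⟩ := this
      exact ⟨φ, h1, h2⟩
    choose u hu1 hu2 using hex
    have hev : ∀ ε : ℝ≥0, 0 < ε → ∀ᶠ j in atTop, u j ∈ {x | I x ≤ ((c + ε : ℝ≥0) : ℝ≥0∞)} := by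
      intro ε hε
      have := (tendsto_one_div_add_atTop_nhds_zero_nat (𝕜 := ℝ)).eventually_lt_const
        (show (0 : ℝ) < ε from hε)
      filter_upwards [this] with j hj
      refine (hu2 j).le.trans ?_
      have : c + 1 / ((j : ℝ≥0) + 1) ≤ c + ε := by
        gcongr
        exact_mod_cast hj.le
      exact_mod_cast this
    obtain ⟨φ, hφ, θ, hθ, hlim⟩ :=
      (h.rate (c + 1)).isSeqCompact.subseq_of_frequently_in (hev 1 one_pos).frequently
    have hφt : I φ ≠ ⊤ := ne_top_of_le_ne_top ENNReal.coe_ne_top hφ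
    -- In a pseudometric space compact sublevel sets need not be closed: each level c + ε gives its
    -- own limit of a subsequence, and `hsep` identifies it with φ.
    have hle : I φ ≤ c := by
      refine ENNReal.le_of_forall_pos_le_add fun ε hε _ => ?_
      obtain ⟨φ', hφ', θ', hθ', hlim'⟩ := (h.rate (c + ε)).isSeqCompact.subseq_of_frequently_in
        (hθ.tendsto_atTop.eventually (hev ε hε)).frequently
      have : φ = φ' := hsep _ _ hφt (ne_top_of_le_ne_top ENNReal.coe_ne_top hφ')
        (tendsto_nhds_unique_inseparable (hlim.comp hθ'.tendsto_atTop) hlim')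
      rw [this]
      exact_mod_cast hφ'
    obtain ⟨ψ, hψ, hvψ⟩ := hG (u ∘ θ) (v ∘ θ) φ (fun j => hu1 _) hlim hφt
    exact ⟨ψ, le_trans (iInf₂_le φ hψ : (⨅ (φ : S) (_ : G φ ψ), I φ) ≤ I φ) hle, θ, hθ, hvψ⟩
  · by_contra hcon
    rw [not_le, EReal.neg_lt_comm] at hcon
    set l := limsup (fun n => ((1 / a n : ℝ) : EReal) * ENNReal.log (P {ω | Z n ω ∈ F})) atTop
    -- For n ≥ k the event Z n ∈ F forces Y n ∈ C k almost surely, so the upper bound for Y applies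
    -- to every C k. These closed sets decrease, and compactness yields one φ of cost at most c in
    -- all of them.
    let C : ℕ → Set S := fun k => closure {x | ∃ m ≥ k, ∃ y ∈ F, R m x y}
    have hC : ∀ k, ((⨅ x ∈ C k, I x : ℝ≥0∞) : EReal) ≤ -l := by
      intro k
      rw [EReal.le_neg]
      refine le_trans ?_ (h.upper (C k) isClosed_closure)
      refine limsup_le_limsup ?_
      filter_upwards [hR, hcoef, eventually_ge_atTop k] with n h1 h2 h3
      refine mul_le_mul_of_nonneg_left (ENNReal.log_monotone (measure_mono_ae ?_)) h2
      filter_upwards [h1] with ω hω hz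
      exact subset_closure ⟨n, h3, _, hz, hω⟩
    obtain ⟨c, hc1, hc2⟩ := EReal.lt_iff_exists_real_btwn.1 hcon
    have hc0 : 0 ≤ c := by
      have : (0 : EReal) ≤ c := (EReal.coe_ennreal_nonneg _).trans ((hC 0).trans hc1.le)
      exact_mod_cast this
    lift c to ℝ≥0 using hc0
    have hcc : (((c : ℝ≥0) : ℝ) : EReal) = ((c : ℝ≥0∞) : EReal) := rfl
    rw [hcc] at hc1 hc2
    rw [EReal.coe_ennreal_lt_coe_ennreal_iff] at hc2
    have hex : ∀ k, ∃ x ∈ C k, I x ≤ c := by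
      intro k
      have := (hC k).trans_lt hc1
      rw [EReal.coe_ennreal_lt_coe_ennreal_iff] at this
      simp only [iInf_lt_iff] at this
      obtain ⟨x, h1, h2⟩ := this
      exact ⟨x, h1, h2.le⟩
    choose w hw1 hw2 using hex
    obtain ⟨φ, hφ, θ, hθ, hlim⟩ := (h.rate c).isSeqCompact hw2
    have hφC : ∀ k, φ ∈ C k := by
      intro k
      refine isClosed_closure.mem_of_tendsto hlim ?_
      filter_upwards [eventually_ge_atTop k] with j hj
      refine closure_mono ?_ (hw1 (θ j))
      rintro x ⟨m, hm, y, hy⟩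
      exact ⟨m, hj.trans ((hθ.id_le j).trans hm), y, hy⟩
    have hex : ∀ j : ℕ, ∃ x m y, j ≤ m ∧ y ∈ F ∧ R m x y ∧ edist x φ < ((j : ℝ≥0∞) + 1)⁻¹ := by
      intro j
      obtain ⟨x, ⟨m, hm, y, hy, hR⟩, hx⟩ := EMetric.mem_closure_iff.1 (hφC j) ((j : ℝ≥0∞) + 1)⁻¹
        (ENNReal.inv_pos.2 (by finiteness))
      exact ⟨x, m, y, hm, hy, hR, by rwa [edist_comm]⟩
    choose u m v hm hv hRm hu using hex
    have hulim : Tendsto u atTop (𝓝 φ) := by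
      rw [tendsto_iff_edist_tendsto_0]
      refine tendsto_of_tendsto_of_tendsto_of_le_of_le tendsto_const_nhds
        ENNReal.tendsto_inv_nat_nhds_zero (fun _ => zero_le) fun j => (hu j).le.trans ?_
      exact ENNReal.inv_le_inv.2 le_self_add
    obtain ⟨⟨ψ, hψ⟩, hall⟩ := hRG m u v φ (tendsto_atTop_mono hm tendsto_id) hRm hulim
      (ne_top_of_le_ne_top ENNReal.coe_ne_top hφ)
    have hψF : ψ ∈ F := hF.mem_of_tendsto (hall ψ hψ) (Eventually.of_forall hv)
    exact absurd hc2 (not_lt.2 ((iInf₂_le ψ hψF).trans ((iInf₂_le φ hψ).trans hφ)))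
  · by_contra hcon
    rw [not_le, EReal.lt_neg_comm] at hcon
    set l := liminf (fun n => ((1 / a n : ℝ) : EReal) * ENNReal.log (P {ω | Z n ω ∈ O})) atTop
    obtain ⟨c, hc1, hc2⟩ := EReal.lt_iff_exists_real_btwn.1 hcon
    have hc0 : 0 ≤ c := by
      have : (0 : EReal) ≤ c := (EReal.coe_ennreal_nonneg _).trans hc1.le
      exact_mod_cast this
    lift c to ℝ≥0 using hc0
    have hcc : (((c : ℝ≥0) : ℝ) : EReal) = ((c : ℝ≥0∞) : EReal) := rfl
    rw [hcc] at hc1 hc2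
    rw [EReal.coe_ennreal_lt_coe_ennreal_iff] at hc1
    simp only [iInf_lt_iff] at hc1
    obtain ⟨ψ, hψ, φ, hφψ, hφ⟩ := hc1
    -- A single k serves both as ball index and as threshold for n, so that a failure for every k
    -- produces a sequence to which `hRG` applies.
    have hball : ∃ k : ℕ, ∀ n ≥ k, ∀ x, edist x φ < ((k : ℝ≥0∞) + 1)⁻¹ →
        ∀ y, R n x y → y ∈ O := by
      by_contra! hno
      choose m hm u hu v hRm hv using hno
      have hulim : Tendsto u atTop (𝓝 φ) := by
        rw [tendsto_iff_edist_tendsto_0]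
        refine tendsto_of_tendsto_of_tendsto_of_le_of_le tendsto_const_nhds
          ENNReal.tendsto_inv_nat_nhds_zero (fun _ => zero_le) fun j => (hu j).le.trans ?_
        exact ENNReal.inv_le_inv.2 le_self_add
      have := (hRG m u v φ (tendsto_atTop_mono hm tendsto_id) hRm hulim hφ.ne_top).2 ψ hφψ
      obtain ⟨j, hj⟩ := (this.eventually_mem (hO.mem_nhds hψ)).exists
      exact hv j hj
    obtain ⟨k, hk⟩ := hball
    have hB : IsOpen {x | edist x φ < ((k : ℝ≥0∞) + 1)⁻¹} :=
      isOpen_lt (continuous_id.edist continuous_const) continuous_const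
    have h1 : -(I φ : EReal) ≤ l := by
      refine le_trans ?_ ((h.lower _ hB).trans ?_)
      · rw [EReal.neg_le_neg_iff, EReal.coe_ennreal_le_coe_ennreal_iff]
        exact iInf₂_le φ (by simp [ENNReal.inv_pos])
      · refine liminf_le_liminf ?_
        filter_upwards [hR, hcoef, eventually_ge_atTop k] with n h1 h2 h3
        refine mul_le_mul_of_nonneg_left (ENNReal.log_monotone (measure_mono_ae ?_)) h2
        filter_upwards [h1] with ω hω hz
        exact hk n h3 _ hz _ hω
    rw [EReal.neg_le] at h1
    have h2 := h1.trans_lt (EReal.coe_ennreal_lt_coe_ennreal_iff.2 hφ)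
    exact absurd hc2 (not_lt.2 h2.le)

/-! ### J₁ convergence to continuous paths -/

namespace DPath

theorem timeChange_zero {T : ℝ} (hT : 0 ≤ T) (f : TimeChange T) :
    f ⟨0, left_mem_Icc.2 hT⟩ = ⟨0, left_mem_Icc.2 hT⟩ := by
  have h0 : ∀ t : Icc (0 : ℝ) T, (⟨0, left_mem_Icc.2 hT⟩ : Icc (0 : ℝ) T) ≤ t := fun t => t.2.1
  refine le_antisymm ?_ (h0 _)
  have := f.monotone (h0 (f.symm ⟨0, left_mem_Icc.2 hT⟩))
  rwa [OrderIso.apply_symm_apply] at this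

/-- Time changes fix 0, so the chord of f from 0 to t has slope f(t)/t, which lies between exp(-η)
and exp(η). -/
theorem abs_timeChange_sub_le {T : ℝ} (f : TimeChange T) {η : ℝ} (hη : 0 ≤ η)
    (h : logNorm f ≤ ENNReal.ofReal η) (t : Icc (0 : ℝ) T) :
    |(f t : ℝ) - t| ≤ T * (Real.exp η - 1) := by
  have hT : 0 ≤ T := t.2.1.trans t.2.2
  have e1 := Real.add_one_le_exp η
  have e2 := Real.add_one_le_exp (-η)
  rcases t.2.1.eq_or_lt with h0 | h0
  · have : t = ⟨0, left_mem_Icc.2 hT⟩ := Subtype.ext h0.symm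
    rw [this, timeChange_zero hT, sub_self, abs_zero]
    exact mul_nonneg hT (by linarith)
  · have hlt : (⟨0, left_mem_Icc.2 hT⟩ : Icc (0 : ℝ) T) < t := h0
    have hf := f.strictMono hlt
    have h1 := (le_logNorm f hlt).trans h
    rw [timeChange_zero hT] at h1 hf
    have hf0 : 0 < (f t : ℝ) := hf
    rw [ENNReal.ofReal_le_ofReal_iff hη] at h1
    simp only [sub_zero] at h1
    have hq : 0 < (f t : ℝ) / t := div_pos hf0 h0
    obtain ⟨h2, h3⟩ := abs_le.1 h1
    have h4 := (Real.log_le_iff_le_exp hq).1 h3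
    have h5 := (Real.le_log_iff_exp_le hq).1 h2
    rw [div_le_iff₀ h0] at h4
    rw [le_div_iff₀ h0] at h5
    have htT : (t : ℝ) * (Real.exp η - 1) ≤ T * (Real.exp η - 1) :=
      mul_le_mul_of_nonneg_right t.2.2 (by linarith)
    rw [abs_le]
    constructor <;> nlinarith

/-- A time change of small logarithmic norm moves points little, and the limit, uniformly continuous
on [0,T], absorbs the displacement. -/
theorem tendstoUniformly_of_tendsto {T : ℝ} {E : Type*} [PseudoEMetricSpace E]
    {u : ℕ → DPath T E} {φ : DPath T E} (hφ : Continuous φ.toFun) (h : Tendsto u atTop (𝓝 φ)) :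
    TendstoUniformly (fun j => (u j).toFun) φ.toFun atTop := by
  rw [EMetric.tendstoUniformly_iff]
  intro ε hε
  obtain ⟨δ, hδ, hu⟩ := EMetric.uniformContinuous_iff.1
    (CompactSpace.uniformContinuous_of_continuous hφ) (ε / 2) (ENNReal.half_pos hε.ne')
  have hη : ∃ η : ℝ, 0 < η ∧ ENNReal.ofReal (T * (Real.exp η - 1)) < δ := by
    have hc : Tendsto (fun η : ℝ => ENNReal.ofReal (T * (Real.exp η - 1))) (𝓝[>] 0) (𝓝 0) := by
      have : Continuous (fun η : ℝ => ENNReal.ofReal (T * (Real.exp η - 1))) :=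
        ENNReal.continuous_ofReal.comp (by fun_prop)
      have h0 := this.tendsto 0
      simp only [Real.exp_zero, sub_self, mul_zero, ENNReal.ofReal_zero] at h0
      exact h0.mono_left nhdsWithin_le_nhds
    obtain ⟨η, h1, h2⟩ := ((hc.eventually_lt_const hδ).and self_mem_nhdsWithin).exists
    exact ⟨η, h2, h1⟩
  obtain ⟨η, hη0, hη⟩ := hη
  rw [tendsto_iff_edist_tendsto_0] at h
  have hpos : 0 < min (ε / 2) (ENNReal.ofReal η) :=
    lt_min (ENNReal.half_pos hε.ne') (ENNReal.ofReal_pos.2 hη0)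
  filter_upwards [h.eventually_lt_const hpos] with j hj t
  obtain ⟨f, hf⟩ := iInf_lt_iff.1 (show j1Dist (u j) φ < _ from hj)
  obtain ⟨hf1, hf2⟩ := max_lt_iff.1 hf
  have h1 : edist ((u j).toFun t) (φ.toFun (f t)) < ε / 2 :=
    ((le_iSup (fun t => edist ((u j).toFun t) (φ.toFun (f t))) t).trans_lt hf2).trans_le
      (min_le_left _ _)
  have h2 : edist (φ.toFun t) (φ.toFun (f t)) < ε / 2 := by
    refine hu (lt_of_le_of_lt ?_ hη)
    rw [edist_comm, Subtype.edist_eq, edist_dist, Real.dist_eq]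
    exact ENNReal.ofReal_le_ofReal
      (abs_timeChange_sub_le f hη0.le (hf1.le.trans (min_le_right _ _)) t)
  calc edist (φ.toFun t) ((u j).toFun t)
      ≤ edist (φ.toFun t) (φ.toFun (f t)) + edist (φ.toFun (f t)) ((u j).toFun t) :=
        edist_triangle _ _ _
    _ < ε / 2 + ε / 2 := ENNReal.add_lt_add h2 (by rwa [edist_comm])
    _ = ε := ENNReal.add_halves ε

theorem tendsto_of_tendstoUniformly {T : ℝ} {E : Type*} [PseudoEMetricSpace E]
    {u : ℕ → DPath T E} {φ : DPath T E}
    (h : TendstoUniformly (fun j => (u j).toFun) φ.toFun atTop) : Tendsto u atTop (𝓝 φ) := by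
  rw [EMetric.tendsto_nhds]
  intro ε hε
  obtain ⟨δ, hδ, hδε⟩ := exists_between hε
  filter_upwards [EMetric.tendstoUniformly_iff.1 h δ hδ] with j hj
  refine lt_of_le_of_lt (iInf_le_of_le (OrderIso.refl _) (max_le ?_ (iSup_le fun t => ?_))) hδε
  · rw [logNorm_refl]
    exact zero_le
  · rw [edist_comm]
    exact (hj t).le

/-- The constant sequence φ converges to φ', hence uniformly. This supplies the separation that the
contraction principle asks for. -/
theorem eq_of_inseparable {T : ℝ} {E : Type*} [PseudoEMetricSpace E] [T2Space E]
    {φ φ' : DPath T E} (hφ' : Continuous φ'.toFun)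
    (h : Inseparable φ φ') : φ = φ' := by
  have h1 : Tendsto (fun _ : ℕ => φ) atTop (𝓝 φ') := by
    rw [← h.nhds_eq]
    exact tendsto_const_nhds
  have h2 : φ.toFun = φ'.toFun := funext fun t => tendsto_nhds_unique tendsto_const_nhds
    ((tendstoUniformly_of_tendsto hφ' h1).tendsto_at t)
  cases φ
  cases φ'
  simpa using h2

end DPath

/-! ### The one-dimensional Skorohod map -/

theorem Continuous.isRCLL {ι E : Type*} [TopologicalSpace ι] [Preorder ι] [TopologicalSpace E]
    {f : ι → E} (hf : Continuous f) : IsRCLL f :=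
  fun t => ⟨hf.continuousWithinAt, f t, (hf.tendsto t).mono_left nhdsWithin_le_nhds⟩

/-- The second component of a solution of the Skorohod problem is the running supremum of the
negative part of the data. -/
theorem SolvesSkorohodProblem.isLUB {T : ℝ} {hT : 0 ≤ T} {ψ φ₁ φ₂ : Icc (0 : ℝ) T → ℝ}
    (h : SolvesSkorohodProblem hT ψ φ₁ φ₂) (t : Icc (0 : ℝ) T) :
    IsLUB ((fun s => max (-ψ s) 0) '' Iic t) (φ₂ t) := by
  have h0 : φ₂ ⟨0, left_mem_Icc.2 hT⟩ = 0 := by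
    have h1 := h.initial
    have h2 := h.decomp ⟨0, left_mem_Icc.2 hT⟩
    linarith
  have hz : ∀ s : Icc (0 : ℝ) T, 0 ≤ φ₂ s := fun s => h0.symm.le.trans (h.mono s.2.1)
  refine ⟨?_, fun M hM => ?_⟩
  · rintro _ ⟨s, hs, rfl⟩
    refine max_le ?_ (hz t)
    have h1 := h.decomp s
    have h2 := h.nonneg s
    have h3 := h.mono hs
    linarith
  · by_contra! hlt
    obtain ⟨c, hMc, hct⟩ := exists_between hlt
    have hM' : ∀ s ≤ t, max (-ψ s) 0 ≤ M := fun s hs => hM ⟨s, hs, rfl⟩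
    have hM0 : 0 ≤ M := (le_max_right _ _).trans (hM' t le_rfl)
    obtain ⟨m, hm, hint⟩ := h.compl
    have hmt : m t = φ₂ t := by rw [hm, IccExtend_val]
    set A : Set ℝ := {s | c < m s}
    have hA0 : ∀ s ∈ A, 0 ≤ s := by
      intro s hs
      by_contra! hs0
      have : m s = 0 := by rw [hm, IccExtend_of_le_left _ _ hs0.le, h0]
      have hs' : c < m s := hs
      linarith
    have hAt : (t : ℝ) ∈ A := by
      change c < m t
      rwa [hmt]
    have hAb : BddBelow A := ⟨0, hA0⟩
    set w := sInf A
    have hw0 : 0 ≤ w := le_csInf ⟨_, hAt⟩ hA0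
    have hwt : w ≤ t := csInf_le hAb hAt
    have hright : ∀ s, w < s → c < m s := by
      intro s hs
      obtain ⟨s', hs', hlt⟩ := exists_lt_of_csInf_lt ⟨_, hAt⟩ hs
      exact lt_of_lt_of_le hs' (m.mono hlt.le)
    have hw : c ≤ m w := by
      refine ge_of_tendsto (((m.right_continuous w).mono Ioi_subset_Ici_self).tendsto) ?_
      filter_upwards [self_mem_nhdsWithin] with s hs
      exact (hright s hs).le
    have hleft : Function.leftLim m w ≤ c := by
      refine le_of_tendsto (m.mono.tendsto_leftLim w) ?_
      filter_upwards [self_mem_nhdsWithin] with s hs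
      by_contra! hc
      exact absurd (csInf_le hAb (show s ∈ A from hc)) (not_le.2 hs)
    have hlow : ∀ s ∈ Icc w t, ENNReal.ofReal (c - M) ≤ ENNReal.ofReal (IccExtend hT φ₁ s) := by
      intro s hs
      have hsT : s ∈ Icc (0 : ℝ) T := ⟨hw0.trans hs.1, hs.2.trans t.2.2⟩
      refine ENNReal.ofReal_le_ofReal ?_
      rw [IccExtend_of_mem _ _ hsT, h.decomp]
      have h1 := (le_max_left _ _).trans (hM' ⟨s, hsT⟩ hs.2)
      have h2 : c ≤ m s := hw.trans (m.mono hs.1)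
      rw [hm, IccExtend_of_mem _ _ hsT] at h2
      linarith
    have hpos : 0 < ENNReal.ofReal (c - M) * m.measure (Icc w t) := by
      rw [StieltjesFunction.measure_Icc, hmt]
      refine ENNReal.mul_pos ?_ ?_ <;> simp only [ne_eq, ENNReal.ofReal_eq_zero, not_le] <;>
        linarith
    have hle : ENNReal.ofReal (c - M) * m.measure (Icc w t)
        ≤ ∫⁻ t, ENNReal.ofReal (IccExtend hT φ₁ t) ∂m.measure := by
      rw [← setLIntegral_const]
      exact (setLIntegral_mono' measurableSet_Icc hlow).trans (setLIntegral_le_lintegral _ _)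
    rw [hint] at hle
    exact absurd hpos (not_lt.2 hle)

/-- The regulator is the running supremum L of h⁻. It inherits continuity from h, and it is locally
constant wherever h + L > 0, so its measure does not charge that set. -/
theorem exists_isSkorohodMap {T : ℝ} (hT : 0 ≤ T) {h : Icc (0 : ℝ) T → ℝ} (hh : Continuous h)
    (h0 : 0 ≤ h ⟨0, left_mem_Icc.2 hT⟩) :
    ∃ ψ : DPath T ℝ, Continuous ψ.toFun ∧ IsSkorohodMap hT h ψ := by
  have hex : ∀ t, ∃ v, IsLUB ((fun s => max (-h s) 0) '' Iic t) v := by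
    intro t
    refine Real.exists_isLUB ⟨_, t, mem_Iic.2 le_rfl, rfl⟩ ?_
    exact ((isCompact_range (by fun_prop : Continuous fun s => max (-h s) 0)).bddAbove).mono
      (image_subset_range _ _)
  choose L hL using hex
  have hneg : ∀ {s t}, s ≤ t → -h s ≤ L t := fun {s t} hst =>
    (le_max_left _ _).trans ((hL t).1 ⟨s, hst, rfl⟩)
  have hL0 : ∀ t, 0 ≤ L t := fun t => (le_max_right _ _).trans ((hL t).1 ⟨t, mem_Iic.2 le_rfl, rfl⟩)
  have hmax : ∀ {t c}, 0 ≤ c → (∀ s ≤ t, -h s ≤ c) → L t ≤ c := by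
    intro t c hc hs
    refine (hL t).2 ?_
    rintro _ ⟨s, hst, rfl⟩
    exact max_le (hs s hst) hc
  have hmono : Monotone L := fun s t hst => hmax (hL0 t) fun u hu => hneg (hu.trans hst)
  have hcont : Continuous L := by
    refine UniformContinuous.continuous (Metric.uniformContinuous_iff.2 fun ε hε => ?_)
    obtain ⟨δ, hδ, hu⟩ := Metric.uniformContinuous_iff.1
      (CompactSpace.uniformContinuous_of_continuous hh) (ε / 2) (half_pos hε)
    have key : ∀ {s t}, s ≤ t → dist s t < δ → L t ≤ L s + ε / 2 := by
      intro s t hst hd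
      refine hmax (by linarith [hL0 s]) fun u hut => ?_
      rcases le_total u s with hus | hsu
      · linarith [hneg hus]
      · have hd' : dist u s < δ := by
          rw [Subtype.dist_eq, Real.dist_eq, abs_of_nonneg (sub_nonneg.2 (Subtype.coe_le_coe.2 hsu))]
          rw [Subtype.dist_eq, Real.dist_eq, abs_of_nonpos (sub_nonpos.2 (Subtype.coe_le_coe.2 hst))] at hd
          have : (u : ℝ) ≤ t := hut
          linarith
        have := (abs_lt.1 (hu hd')).1
        linarith [hneg (le_refl s)]
    refine ⟨δ, hδ, fun {s t} hd => ?_⟩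
    rw [Real.dist_eq, abs_lt]
    rcases le_total s t with hst | hst
    · have := key hst hd
      have := hmono hst
      constructor <;> linarith
    · have := key hst (by rwa [dist_comm])
      have := hmono hst
      constructor <;> linarith
  have hL00 : L ⟨0, left_mem_Icc.2 hT⟩ = 0 := by
    refine le_antisymm (hmax le_rfl fun s hs => ?_) (hL0 _)
    have : s = ⟨0, left_mem_Icc.2 hT⟩ := le_antisymm hs s.2.1
    rw [this]
    linarith
  have hΦ : Continuous (IccExtend hT L) := hcont.Icc_extend'
  have hH : Continuous (IccExtend hT h) := hh.Icc_extend'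
  let m : StieltjesFunction ℝ :=
    ⟨IccExtend hT L, hmono.IccExtend hT, fun t => hΦ.continuousWithinAt⟩
  refine ⟨⟨fun t => h t + L t, (hh.add hcont).isRCLL⟩, hh.add hcont, L, ?_, fun t => rfl,
    fun t => ?_, hmono, m, fun t => rfl, ?_⟩
  · simp [hL00]
  · have := hneg (le_refl t)
    simp only
    linarith
  have hsum : ∀ t, IccExtend hT (fun t => h t + L t) t = IccExtend hT h t + IccExtend hT L t :=
    fun t => rfl
  simp only [hsum]
  rw [lintegral_eq_zero_iff (by fun_prop)]
  refine measure_null_of_locally_null _ fun t ht => ?_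
  have ht' : 0 < IccExtend hT h t + IccExtend hT L t := by
    by_contra! hc
    exact ht (ENNReal.ofReal_of_nonpos hc)
  -- With half the gap, near t one has -h(s) < ε - h(t) = L(t) - ε < L(t - δ/2), so no new record of
  -- -h is set there.
  set ε := (IccExtend hT h t + IccExtend hT L t) / 2 with hε
  have hev : ∀ᶠ s in 𝓝 t, IccExtend hT h t - ε < IccExtend hT h s ∧
      IccExtend hT L t - ε < IccExtend hT L s :=
    ((hH.tendsto t).eventually_const_lt (by linarith)).and
      ((hΦ.tendsto t).eventually_const_lt (by linarith))
  obtain ⟨δ, hδ, hball⟩ := Metric.eventually_nhds_iff.1 hev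
  have hin : ∀ s ∈ Icc (t - δ / 2) (t + δ / 2), IccExtend hT h t - ε < IccExtend hT h s ∧
      IccExtend hT L t - ε < IccExtend hT L s := by
    intro s hs
    refine hball ?_
    rw [Real.dist_eq, abs_lt]
    constructor <;> linarith [hs.1, hs.2]
  have ha := (hin (t - δ / 2) ⟨le_rfl, by linarith⟩).2
  have hconst : IccExtend hT L (t + δ / 2) ≤ IccExtend hT L (t - δ / 2) := by
    refine hmax (hL0 _) fun s hs => ?_
    rcases le_total (s : ℝ) (t - δ / 2) with h1 | h1
    · refine hneg ?_
      have := monotone_projIcc hT h1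
      rwa [projIcc_val] at this
    rcases le_total (s : ℝ) (t + δ / 2) with h2 | h2
    · have h3 := (hin s ⟨h1, h2⟩).1
      rw [IccExtend_val] at h3
      linarith
    · have h3 : s = projIcc 0 T hT (t + δ / 2) := by
        refine le_antisymm hs ?_
        have := monotone_projIcc hT h2
        rwa [projIcc_val] at this
      have h4 := (hin (t + δ / 2) ⟨by linarith, le_rfl⟩).1
      rw [h3]
      change _ < h _ at h4
      linarith
  refine ⟨Ioc (t - δ / 2) (t + δ / 2),
    mem_nhdsWithin_of_mem_nhds (Ioc_mem_nhds (by linarith) (by linarith)), ?_⟩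
  rw [StieltjesFunction.measure_Ioc]
  exact ENNReal.ofReal_of_nonpos (sub_nonpos.2 hconst)

theorem SolvesSkorohodProblem.neg_le {T : ℝ} {hT : 0 ≤ T} {ψ φ₁ φ₂ : Icc (0 : ℝ) T → ℝ}
    (h : SolvesSkorohodProblem hT ψ φ₁ φ₂) {s t : Icc (0 : ℝ) T} (hst : s ≤ t) :
    -ψ s ≤ φ₂ t :=
  (le_max_left _ _).trans ((h.isLUB t).1 ⟨s, hst, rfl⟩)

theorem SolvesSkorohodProblem.regulator_nonneg {T : ℝ} {hT : 0 ≤ T} {ψ φ₁ φ₂ : Icc (0 : ℝ) T → ℝ}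
    (h : SolvesSkorohodProblem hT ψ φ₁ φ₂) (t : Icc (0 : ℝ) T) : 0 ≤ φ₂ t :=
  (le_max_right _ _).trans ((h.isLUB t).1 ⟨t, mem_Iic.2 le_rfl, rfl⟩)

theorem SolvesSkorohodProblem.regulator_le {T : ℝ} {hT : 0 ≤ T} {ψ φ₁ φ₂ : Icc (0 : ℝ) T → ℝ}
    (h : SolvesSkorohodProblem hT ψ φ₁ φ₂) {t : Icc (0 : ℝ) T} {c : ℝ} (hc : 0 ≤ c)
    (hs : ∀ s ≤ t, -ψ s ≤ c) : φ₂ t ≤ c := by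
  refine (h.isLUB t).2 ?_
  rintro _ ⟨s, hst, rfl⟩
  exact max_le (hs s hst) hc

/-- The Skorohod map is continuous for the uniform distance. -/
theorem IsSkorohodMap.tendstoUniformly {T : ℝ} {hT : 0 ≤ T} {h : ℕ → Icc (0 : ℝ) T → ℝ}
    {y : ℕ → Icc (0 : ℝ) T → ℝ} {h' ψ : Icc (0 : ℝ) T → ℝ}
    (hy : ∀ j, IsSkorohodMap hT (h j) (y j)) (hψ : IsSkorohodMap hT h' ψ)
    (hh : TendstoUniformly h h' atTop) : TendstoUniformly y ψ atTop := by
  choose L hL using hy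
  obtain ⟨K, hK⟩ := hψ
  rw [Metric.tendstoUniformly_iff] at hh ⊢
  intro ε hε
  filter_upwards [hh (ε / 4) (by linarith)] with j hj t
  have hd : ∀ s, |h' s - h j s| < ε / 4 := hj
  have h1 : L j t ≤ K t + ε / 4 :=
    (hL j).regulator_le (by linarith [hK.regulator_nonneg t]) fun s hs => by
      linarith [hK.neg_le hs, (abs_lt.1 (hd s)).2]
  have h2 : K t ≤ L j t + ε / 4 :=
    hK.regulator_le (by linarith [(hL j).regulator_nonneg t]) fun s hs => by
      linarith [(hL j).neg_le hs, (abs_lt.1 (hd s)).1]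
  have h3 := abs_lt.1 (hd t)
  rw [Real.dist_eq, abs_lt, hK.decomp, (hL j).decomp]
  constructor <;> linarith [h3.1, h3.2]

/-! ### Penalized reflections and their limit -/

/-- `y = h + L`, where the nondecreasing `L` does not grow while `y` is nonnegative and grows
at rate at least `μ` times the negative part of `y` otherwise. -/
structure IsPenalizedReflection {T : ℝ} (hT : 0 ≤ T) (μ : ℝ) (h y L : Icc (0 : ℝ) T → ℝ) :
    Prop where
  decomp : ∀ t, y t = h t + L t
  zero : L ⟨0, left_mem_Icc.2 hT⟩ = 0
  mono : Monotone L
  cont : Continuous L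
  flat : ∀ s t, s ≤ t → (∀ u, s < u → u ≤ t → 0 ≤ y u) → L t = L s
  growth : ∀ ε > 0, ∀ s t, s ≤ t → (∀ u, s ≤ u → u ≤ t → y u ≤ -ε) →
    μ * (ε * ((t : ℝ) - s)) ≤ L t - L s

namespace IsPenalizedReflection

theorem penalty_nonneg {T : ℝ} {hT : 0 ≤ T} {μ : ℝ} {h y L : Icc (0 : ℝ) T → ℝ}
    (hp : IsPenalizedReflection hT μ h y L) (t : Icc (0 : ℝ) T) : 0 ≤ L t :=
  hp.zero.symm.le.trans (hp.mono t.2.1)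

/-- After the last time w at which L ≤ c, one has L > c ≥ -h, so y > 0 and L stays flat: it cannot
have risen above c. The bound does not involve the rate μ. -/
theorem penalty_le {T : ℝ} {hT : 0 ≤ T} {μ : ℝ} {h y L : Icc (0 : ℝ) T → ℝ}
    (hp : IsPenalizedReflection hT μ h y L) {t : Icc (0 : ℝ) T} {c : ℝ} (hc : 0 ≤ c)
    (hs : ∀ s ≤ t, -h s ≤ c) : L t ≤ c := by
  by_contra! hlt
  have hcl : IsClosed {s | s ≤ t ∧ L s ≤ c} :=
    (isClosed_le continuous_id continuous_const).inter (isClosed_le hp.cont continuous_const)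
  obtain ⟨w, ⟨hwt, hw⟩, hmax⟩ := hcl.isCompact.exists_isGreatest
    ⟨⟨0, left_mem_Icc.2 hT⟩, t.2.1, hp.zero.trans_le hc⟩
  have := hp.flat w t hwt fun u hwu hut => by
    have h1 : c < L u := by
      by_contra! hc
      exact absurd (hmax ⟨hut, hc⟩) (not_le.2 hwu)
    rw [hp.decomp]
    linarith [hs u hut]
  linarith

/-- Penalized reflections with rates tending to infinity converge to the Skorohod reflection. -/
theorem tendstoUniformly {T : ℝ} {hT : 0 ≤ T} {μ : ℕ → ℝ} {h y L : ℕ → Icc (0 : ℝ) T → ℝ}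
    (hp : ∀ j, IsPenalizedReflection hT (μ j) (h j) (y j) (L j)) (hμ : Tendsto μ atTop atTop)
    {h' ψ : Icc (0 : ℝ) T → ℝ} (hh' : Continuous h') (hψ : IsSkorohodMap hT h' ψ)
    (hh : TendstoUniformly h h' atTop) : TendstoUniformly y ψ atTop := by
  obtain ⟨K, hK⟩ := hψ
  have h0 : 0 ≤ h' ⟨0, left_mem_Icc.2 hT⟩ := hK.initial.symm ▸ hK.nonneg _
  rw [Metric.tendstoUniformly_iff] at hh ⊢
  intro ε hε
  obtain ⟨B, hB⟩ := (isCompact_range hh').bddBelow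
  have hB' : ∀ t, B ≤ h' t := fun t => hB ⟨t, rfl⟩
  obtain ⟨δ, hδ, hu⟩ := Metric.uniformContinuous_iff.1
    (CompactSpace.uniformContinuous_of_continuous hh') (ε / 16) (by linarith)
  -- At such rates, staying below -ε/16 for a time δ/2 would push L beyond its a priori bound |B| +
  -- ε.
  have hμ' := hμ.eventually_gt_atTop ((|B| + ε) / (ε / 16 * (δ / 2)))
  filter_upwards [hh (ε / 16) (by linarith), hμ'] with j hj hμj t
  have hd : ∀ s, |h' s - h j s| < ε / 16 := hj
  have hLC : ∀ t, L j t ≤ |B| + ε := fun t =>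
    (hp j).penalty_le (by positivity) fun s _ => by
      linarith [(abs_lt.1 (hd s)).2, hB' s, neg_abs_le B]
  have hy : ∀ t, -(ε / 4) ≤ y j t := by
    intro t
    by_contra! hlt
    -- Going back in time, L only decreases and the input changes by at most 3ε/16: once for the
    -- modulus of h', twice for the distance from h j to h'.
    have hback : ∀ s, s ≤ t → dist t s < δ → y j s ≤ -(ε / 16) := by
      intro s hst hts
      have h1 := (abs_lt.1 (hu hts)).1
      have h2 := (abs_lt.1 (hd s)).1
      have h3 := (abs_lt.1 (hd t)).2
      have h4 := (hp j).mono hst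
      have h5 := (hp j).decomp s
      have h6 := (hp j).decomp t
      linarith
    have hdist : ∀ s : Icc (0 : ℝ) T, s ≤ t → (t : ℝ) - s < δ → dist t s < δ := by
      intro s hst hlt
      rwa [Subtype.dist_eq, Real.dist_eq, abs_of_nonneg (sub_nonneg.2 (Subtype.coe_le_coe.2 hst))]
    -- When there is no room for an interval before t, going back to time 0 contradicts h'(0) ≥ 0.
    rcases lt_or_ge (t : ℝ) δ with htδ | htδ
    · have h1 := hback ⟨0, left_mem_Icc.2 hT⟩ t.2.1 (hdist _ t.2.1 (by simpa using htδ))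
      have h2 := (abs_lt.1 (hd ⟨0, left_mem_Icc.2 hT⟩)).2
      have h3 := (abs_lt.1 (hd ⟨0, left_mem_Icc.2 hT⟩)).1
      rw [(hp j).decomp, (hp j).zero] at h1
      linarith
    · have hsT : (t : ℝ) - δ / 2 ∈ Icc (0 : ℝ) T := ⟨by linarith, by linarith [t.2.2]⟩
      have hst : (⟨t - δ / 2, hsT⟩ : Icc (0 : ℝ) T) ≤ t :=
        Subtype.coe_le_coe.1 (by simp only; linarith)
      have h1 := (hp j).growth (ε / 16) (by linarith) ⟨t - δ / 2, hsT⟩ t hst fun u hu1 hu2 => by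
        have h2 : (t : ℝ) - δ / 2 ≤ u := hu1
        exact hback u hu2 (hdist u hu2 (by linarith))
      rw [div_lt_iff₀ (by positivity)] at hμj
      have h3 := hLC t
      have h4 := (hp j).penalty_nonneg ⟨t - δ / 2, hsT⟩
      simp only [sub_sub_cancel] at h1
      linarith
  have h1 : L j t ≤ K t + ε / 16 :=
    (hp j).penalty_le (by linarith [hK.regulator_nonneg t]) fun s hs => by
      linarith [hK.neg_le hs, (abs_lt.1 (hd s)).2]
  have h2 : K t ≤ L j t + (ε / 4 + ε / 16) :=
    hK.regulator_le (by linarith [(hp j).penalty_nonneg t]) fun s hs => by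
      linarith [(hp j).mono hs, (hp j).decomp s, hy s, (abs_lt.1 (hd s)).1]
  have h3 := abs_lt.1 (hd t)
  rw [Real.dist_eq, abs_lt, hK.decomp, (hp j).decomp]
  constructor <;> linarith [h3.1, h3.2]

/-- Inputs read through time changes whose delay is a vanishing multiple of the penalty converge
to the input without time change. -/
theorem input_tendstoUniformly {T : ℝ} {hT : 0 ≤ T} {μ : ℕ → ℝ} {y L : ℕ → Icc (0 : ℝ) T → ℝ}
    {z r κ : ℕ → ℝ} {x r' : ℝ} {φ : ℕ → Icc (0 : ℝ) T → EuclideanSpace ℝ (Fin 2)}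
    {φ' : Icc (0 : ℝ) T → EuclideanSpace ℝ (Fin 2)} {τ : ℕ → Icc (0 : ℝ) T → Icc (0 : ℝ) T}
    (hp : ∀ j, IsPenalizedReflection hT (μ j)
      (fun t : Icc (0 : ℝ) T => z j + r j * (t : ℝ) + φ j t 0 - φ j (τ j t) 1) (y j) (L j))
    (hτ : ∀ j (t : Icc (0 : ℝ) T), (t : ℝ) - τ j t = κ j * L j t)
    (hz : Tendsto z atTop (𝓝 x)) (hr : Tendsto r atTop (𝓝 r')) (hκ : Tendsto κ atTop (𝓝 0))
    (hφ' : Continuous φ') (hφ : TendstoUniformly φ φ' atTop) :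
    TendstoUniformly (fun j (t : Icc (0 : ℝ) T) => z j + r j * (t : ℝ) + φ j t 0 - φ j (τ j t) 1)
      (fun t : Icc (0 : ℝ) T => x + r' * (t : ℝ) + φ' t 0 - φ' t 1) atTop := by
  have hcoord : ∀ (v w : EuclideanSpace ℝ (Fin 2)) (i : Fin 2), |v i - w i| ≤ dist v w := by
    intro v w i
    rw [dist_eq_norm]
    exact PiLp.norm_apply_le (v - w) i
  rw [Metric.tendstoUniformly_iff] at hφ ⊢
  obtain ⟨B, hB⟩ := (isCompact_range (by fun_prop : Continuous fun t => dist (φ' t) 0)).bddAbove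
  have hB' : ∀ t, dist (φ' t) 0 ≤ B := fun t => hB ⟨t, rfl⟩
  -- C bounds the input whatever the values of τ, hence also L by `penalty_le`. There is thus no
  -- circularity although τ is defined through L.
  set C := |x| + 1 + (|r'| + 1) * T + 2 * (|B| + 1) with hC
  have hC0 : 0 < C := by positivity
  intro ε hε
  obtain ⟨δ, hδ, hu⟩ := Metric.uniformContinuous_iff.1
    (CompactSpace.uniformContinuous_of_continuous hφ') (ε / 8) (by linarith)
  have hη : 0 < min 1 (ε / 8 / (T + 1)) := by positivity
  have hz' := Metric.tendsto_nhds.1 hz (min 1 (ε / 8)) (by positivity)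
  have hr'' := Metric.tendsto_nhds.1 hr (min 1 (ε / 8 / (T + 1))) hη
  have hκ' := Metric.tendsto_nhds.1 hκ (δ / C) (by positivity)
  filter_upwards [hφ (min 1 (ε / 8)) (by positivity), hz', hr'', hκ'] with j h1 h2 h3 h4
  rw [Real.dist_eq] at h2 h3 h4
  rw [sub_zero, lt_div_iff₀ hC0] at h4
  obtain ⟨h2a, h2b⟩ := lt_min_iff.1 h2
  obtain ⟨h3a, h3b⟩ := lt_min_iff.1 h3
  rw [lt_div_iff₀ (by linarith)] at h3b
  have hφj : ∀ t i, |φ' t i - φ j t i| < 1 ∧ |φ' t i - φ j t i| < ε / 8 := fun t i =>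
    lt_min_iff.1 ((hcoord _ _ i).trans_lt (h1 t))
  have hφB : ∀ t i, |φ' t i| ≤ |B| := fun t i => by
    have := hcoord (φ' t) 0 i
    simp only [PiLp.zero_apply, sub_zero] at this
    exact (this.trans (hB' t)).trans (le_abs_self B)
  have hL : ∀ t, L j t ≤ C := fun t => (hp j).penalty_le hC0.le fun s _ => by
    have e1 := abs_lt.1 h2a
    have e2 := abs_le.1 (hφB s 0)
    have e3 := abs_le.1 (hφB (τ j s) 1)
    have e4 := abs_lt.1 (hφj s 0).1
    have e5 := abs_lt.1 (hφj (τ j s) 1).1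
    have e6 : |r j| ≤ |r'| + 1 := by
      have := abs_sub_abs_le_abs_sub (r j) r'
      linarith
    have e7 : |r j * (s : ℝ)| ≤ (|r'| + 1) * T := by
      rw [abs_mul, abs_of_nonneg s.2.1]
      exact mul_le_mul e6 s.2.2 s.2.1 (by positivity)
    have e8 := neg_abs_le (r j * (s : ℝ))
    have e9 := neg_abs_le x
    linarith [e1.1, e2.1, e3.2, e4.2, e5.1]
  intro t
  have hτt : dist t (τ j t) < δ := by
    rw [Subtype.dist_eq, Real.dist_eq, hτ, abs_mul, abs_of_nonneg ((hp j).penalty_nonneg t)]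
    exact (mul_le_mul_of_nonneg_left (hL t) (abs_nonneg _)).trans_lt h4
  have e1 := abs_lt.1 ((hcoord _ _ 1).trans_lt (hu hτt))
  have e2 := abs_lt.1 (hφj t 0).2
  have e3 := abs_lt.1 (hφj (τ j t) 1).2
  have e4 := abs_lt.1 h2b
  have e5 : |(r j - r') * (t : ℝ)| ≤ |r j - r'| * (T + 1) := by
    rw [abs_mul, abs_of_nonneg t.2.1]
    exact mul_le_mul_of_nonneg_left (by linarith [t.2.2]) (abs_nonneg _)
  have e6 := abs_lt.1 (e5.trans_lt h3b)
  rw [Real.dist_eq, abs_lt]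
  constructor <;> linarith [e1.1, e1.2, e2.1, e2.2, e3.1, e3.2, e4.1, e4.2, e6.1, e6.2]

end IsPenalizedReflection

/-! ### From queue paths to penalized reflections -/

/-- By right continuity f is the limit of its values at grid points just to the right. It makes the
integral of the number in service meaningful. -/
theorem IsRCLL.measurable {f : ℝ≥0 → ℕ} (hf : IsRCLL f) : Measurable f := by
  refine measurable_of_tendsto_metrizable
    (f := fun (k : ℕ) s => f (((⌊((k : ℝ≥0) + 1) * s⌋₊ : ℝ≥0) + 1) / ((k : ℝ≥0) + 1))) ?_ ?_
  · intro k
    exact (measurable_of_countable fun m : ℕ => f (((m : ℝ≥0) + 1) / ((k : ℝ≥0) + 1))).comp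
      (Nat.measurable_floor.comp (measurable_const_mul _))
  · rw [tendsto_pi_nhds]
    intro s
    refine (hf s).1.tendsto.comp (tendsto_nhdsWithin_iff.2 ⟨?_, Eventually.of_forall fun k => ?_⟩)
    · have h1 : Tendsto (fun k : ℕ => s + 1 / ((k : ℝ≥0) + 1)) atTop (𝓝 (s + 0)) :=
        tendsto_const_nhds.add tendsto_one_div_add_atTop_nhds_zero_nat
      rw [add_zero] at h1
      refine tendsto_of_tendsto_of_tendsto_of_le_of_le tendsto_const_nhds h1 (fun k => ?_)
        fun k => ?_
      · rw [le_div_iff₀ (by positivity), mul_comm]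
        exact (Nat.lt_floor_add_one _).le
      · simp only
        rw [div_le_iff₀ (by positivity), add_mul s, one_div_mul_cancel (by positivity), mul_comm s]
        gcongr
        exact Nat.floor_le zero_le
    · rw [mem_Ici, le_div_iff₀ (by positivity), mul_comm]
      exact (Nat.lt_floor_add_one _).le

theorem arrivalCount_zero {Ω : Type*} {IA : ℕ → Ω → ℝ} {lam : ℝ} {ω : Ω} (hlam : 0 < lam)
    (h : ∀ k, 0 < IA k ω) : arrivalCount IA lam ω 0 = 0 := by
  have : {l : ℕ | ∑ k ∈ Finset.range l, IA k ω / lam ≤ 0} = {0} := by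
    ext l
    simp only [mem_ofPred_eq, mem_singleton_iff]
    refine ⟨fun hl => ?_, fun hl => by simp [hl]⟩
    by_contra h0
    have : 0 < ∑ k ∈ Finset.range l, IA k ω / lam :=
      Finset.sum_pos (fun k _ => div_pos (h k) hlam) (Finset.nonempty_range_iff.2 h0)
    linarith
  rw [arrivalCount, this, csSup_singleton]

/-- The integral of a bounded rate `μ * max (-y) 0` is a penalty for `y`. -/
theorem IsPenalizedReflection.of_integral {T : ℝ} (hT : 0 ≤ T) {μ C : ℝ} (hμ : 0 ≤ μ) {y : ℝ → ℝ}
    (hy : Measurable y) (hC : ∀ s, -C ≤ y s) {h : Icc (0 : ℝ) T → ℝ}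
    (hd : ∀ t : Icc (0 : ℝ) T, y t = h t + μ * ∫ s in (0 : ℝ)..t, max (-y s) 0) :
    IsPenalizedReflection hT μ h (fun t => y t)
      (fun t => μ * ∫ s in (0 : ℝ)..t, max (-y s) 0) := by
  have hint : ∀ a b, IntervalIntegrable (fun s => max (-y s) 0) volume a b := fun a b => by
    refine (intervalIntegrable_const (c := |C|)).mono_fun'
      (hy.neg.max measurable_const).aestronglyMeasurable (ae_of_all _ fun s => ?_)
    simp only [Real.norm_eq_abs]
    rw [abs_of_nonneg (le_max_right _ _)]
    exact max_le (by linarith [hC s, le_abs_self C]) (abs_nonneg _)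
  have hsub : ∀ s t : ℝ, (μ * ∫ u in (0 : ℝ)..t, max (-y u) 0) - μ * ∫ u in (0 : ℝ)..s, max (-y u) 0
      = μ * ∫ u in s..t, max (-y u) 0 := fun s t => by
    rw [← mul_sub, intervalIntegral.integral_interval_sub_left (hint _ _) (hint _ _)]
  refine ⟨hd, by simp, fun s t hst => ?_, ?_, fun s t hst hu => ?_, fun ε hε s t hst hu => ?_⟩
  · rw [← sub_nonneg]
    rw [hsub]
    exact mul_nonneg hμ (intervalIntegral.integral_nonneg hst fun u _ => le_max_right _ _)
  · exact continuous_const.mul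
      ((intervalIntegral.continuous_primitive hint 0).comp continuous_subtype_val)
  · rw [← sub_eq_zero]
    rw [hsub, intervalIntegral.integral_zero_ae, mul_zero]
    refine ae_of_all _ fun u hu' => ?_
    rw [uIoc_of_le (Subtype.coe_le_coe.2 hst)] at hu'
    have := hu ⟨u, s.2.1.trans hu'.1.le, hu'.2.trans t.2.2⟩ hu'.1 hu'.2
    exact max_eq_right (neg_nonpos.2 this)
  · rw [hsub]
    refine mul_le_mul_of_nonneg_left ?_ hμ
    have h1 := intervalIntegral.integral_mono_on (μ := volume) (Subtype.coe_le_coe.2 hst)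
      (intervalIntegrable_const (c := ε)) (hint s t) fun u hu' => by
        have := hu ⟨u, s.2.1.trans hu'.1, hu'.2.trans t.2.2⟩ hu'.1 hu'.2
        exact le_max_of_le_left (by linarith)
    rw [intervalIntegral.integral_const, smul_eq_mul] at h1
    linarith

/-- A path of a many-server queue, scaled by `c`, is a penalized reflection of the scaled
primitives, with the service process read through a delayed time. -/
theorem exists_isPenalizedReflection_of_queue {T : ℝ} (hT : 0 ≤ T) {X : ℝ≥0 → ℕ} (hX : IsRCLL X)
    {A : ℝ → ℕ} {S : ℝ≥0 → ℕ} {lam mu c : ℝ} {N x₀ : ℕ} (hmu : 0 < mu) (hN : 0 < N) (hc : 0 < c)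
    (hdyn : ∀ t : ℝ≥0, (X t : ℝ) = (x₀ : ℝ) + (A t : ℝ) - (S (Real.toNNReal
      (mu * ∫ s in (0 : ℝ)..t, ((min (X s.toNNReal) N : ℕ) : ℝ))) : ℝ))
    {φ : Icc (0 : ℝ) T → EuclideanSpace ℝ (Fin 2)} {y : Icc (0 : ℝ) T → ℝ}
    (hφ0 : ∀ t : Icc (0 : ℝ) T, φ t 0 = 1 / c * (A t - lam * t))
    (hφ1 : ∀ t : Icc (0 : ℝ) T, φ t 1 = 1 / c * (S (Real.toNNReal (N * mu * t)) - N * mu * t))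
    (hy : ∀ t : Icc (0 : ℝ) T, y t = 1 / c * ((X (t : ℝ).toNNReal : ℝ) - N)) :
    ∃ (τ : Icc (0 : ℝ) T → Icc (0 : ℝ) T) (L : Icc (0 : ℝ) T → ℝ),
      IsPenalizedReflection hT mu (fun t => 1 / c * ((x₀ : ℝ) - N) + (lam - N * mu) / c * (t : ℝ)
        + φ t 0 - φ (τ t) 1) y L ∧
      ∀ t : Icc (0 : ℝ) T, (t : ℝ) - τ t = c / (N * mu) * L t := by
  have hN' : (0 : ℝ) < N := Nat.cast_pos.2 hN
  set Y : ℝ → ℝ := fun s => 1 / c * ((X s.toNNReal : ℝ) - N) with hYdef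
  have hYm : Measurable Y :=
    ((measurable_from_nat.comp (hX.measurable.comp measurable_real_toNNReal)).sub_const
      (N : ℝ)).const_mul (1 / c)
  have hYC : ∀ s, -(1 / c * N) ≤ Y s := fun s => by
    have : (0 : ℝ) ≤ 1 / c * X s.toNNReal := by positivity
    simp only [hYdef, mul_sub]
    linarith
  have hmin : ∀ s : ℝ, ((min (X s.toNNReal) N : ℕ) : ℝ) = N - c * max (-Y s) 0 := by
    intro s
    have h1 : c * max (-Y s) 0 = max ((N : ℝ) - X s.toNNReal) 0 := by
      rw [mul_max_of_nonneg _ _ hc.le, mul_zero]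
      congr 1
      simp only [hYdef]
      field_simp
      ring
    rw [h1, Nat.cast_min]
    rcases le_total (X s.toNNReal : ℝ) N with h | h
    · rw [min_eq_left h, max_eq_left (by linarith)]
      ring
    · rw [min_eq_right h, max_eq_right (by linarith)]
      ring
  have hint : ∀ a b, IntervalIntegrable (fun s => max (-Y s) 0) volume a b := fun a b => by
    refine (intervalIntegrable_const (c := 1 / c * N)).mono_fun'
      (hYm.neg.max measurable_const).aestronglyMeasurable (ae_of_all _ fun s => ?_)
    simp only [Real.norm_eq_abs]
    rw [abs_of_nonneg (le_max_right _ _)]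
    exact max_le (by linarith [hYC s]) (by positivity)
  set D : ℝ → ℝ := fun t => ∫ s in (0 : ℝ)..t, max (-Y s) 0 with hD
  have hbusy : ∀ t : ℝ, ∫ s in (0 : ℝ)..t, ((min (X s.toNNReal) N : ℕ) : ℝ) = N * t - c * D t := by
    intro t
    simp only [hmin]
    rw [intervalIntegral.integral_sub intervalIntegrable_const ((hint _ _).const_mul c),
      intervalIntegral.integral_const_mul, intervalIntegral.integral_const, smul_eq_mul]
    ring
  have hD0 : ∀ t, 0 ≤ t → 0 ≤ D t := fun t ht =>
    intervalIntegral.integral_nonneg ht fun u _ => le_max_right _ _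
  have hDt : ∀ t, 0 ≤ t → 0 ≤ N * t - c * D t := fun t ht => by
    rw [← hbusy]
    exact intervalIntegral.integral_nonneg ht fun u _ => Nat.cast_nonneg _
  -- This delayed time is the busy time averaged over the N servers, hence nonnegative, and N mu
  -- times it is the argument of S in the dynamics.
  have hτ : ∀ t : Icc (0 : ℝ) T, (t : ℝ) - c / N * D t ∈ Icc (0 : ℝ) T := by
    intro t
    have h1 : (t : ℝ) - c / N * D t = (N * t - c * D t) / N := by
      field_simp
    constructor
    · rw [h1]
      exact div_nonneg (hDt t t.2.1) hN'.le
    · have : 0 ≤ c / N * D t := mul_nonneg (by positivity) (hD0 t t.2.1)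
      linarith [t.2.2]
  refine ⟨fun t => ⟨_, hτ t⟩, fun t => mu * D t, ?_, fun t => ?_⟩
  · have hyY : y = fun t : Icc (0 : ℝ) T => Y t := funext hy
    rw [hyY]
    refine IsPenalizedReflection.of_integral hT hmu.le hYm hYC fun t => ?_
    have h1 := hdyn (t : ℝ).toNNReal
    rw [Real.coe_toNNReal _ t.2.1, hbusy] at h1
    rw [hφ0, hφ1]
    have h2 : (N : ℝ) * mu * (t - c / N * D t) = mu * (N * t - c * D t) := by
      field_simp
    simp only [h2]
    change 1 / c * ((X (t : ℝ).toNNReal : ℝ) - N) = _ + mu * D t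
    rw [h1]
    field_simp
    ring
  · simp only
    field_simp
    ring

/-! ### The large deviation principle for the queue -/

theorem theorem1 {Ω : Type*} [MeasurableSpace Ω] (P : Measure Ω) [IsProbabilityMeasure P]
    (T : ℝ) (hT : 0 < T)
    -- primitives: inter-arrival times and an independent standard Poisson process
    (IA : ℕ → Ω → ℝ) (hIA : IsInterarrivalSequence P IA)
    (S : ℝ≥0 → Ω → ℕ) (hS : IsStandardPoissonProcess P S)
    (hindep : IndepFun (fun ω k => IA k ω) (fun ω t => S t ω) P)
    -- parameters of the systems and the moderate deviation, heavy traffic assumptions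
    (lam mu b : ℕ → ℝ) (N : ℕ → ℕ)
    (hlam_pos : ∀ n, 0 < lam n) (hmu_pos : ∀ n, 0 < mu n) (hN_pos : ∀ n, 0 < N n)
    (hb : Tendsto b atTop atTop)
    (hb' : Tendsto (fun n : ℕ => b n / √(n : ℝ)) atTop (𝓝 0))
    (lamLim muLim r : ℝ) (hlamLim_pos : 0 < lamLim) (hmuLim_pos : 0 < muLim)
    (hlam : Tendsto (fun n : ℕ => lam n / n) atTop (𝓝 lamLim))
    (hmu : Tendsto (fun n : ℕ => N n * mu n / n) atTop (𝓝 muLim))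
    (hr : Tendsto (fun n : ℕ => √(n : ℝ) / b n * (lam n / n - N n * mu n / n)) atTop (𝓝 r))
    (hN : Tendsto (fun n : ℕ => (N n : ℝ) / n) atTop (𝓝 0))
    -- the customers-in-system processes, with deterministic initial states
    (X : ℕ → ℝ≥0 → Ω → ℕ) (x₀ : ℕ → ℕ)
    (hX : ∀ n, IsCustomersInSystem P IA S (lam n) (mu n) (N n) (x₀ n) (X n))
    (x : ℝ) (hx : 0 ≤ x)
    (hx₀ : Tendsto (fun n : ℕ => 1 / (b n * √(n : ℝ)) * ((x₀ n : ℝ) - N n)) atTop (𝓝 x))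
    -- the scaled processes, as random elements of the path spaces
    (AS : ℕ → Ω → DPath T (EuclideanSpace ℝ (Fin 2)))
    (hAS : ∀ n, ∀ᵐ ω ∂P, ∀ t : Icc (0 : ℝ) T,
      AS n ω t = !₂[scaledArrival IA (lam n) (b n) n ω t,
        scaledService S (mu n) (b n) (N n) n ω t])
    (Xs : ℕ → Ω → DPath T ℝ)
    (hXs : ∀ n, ∀ᵐ ω ∂P, ∀ t : Icc (0 : ℝ) T,
      Xs n ω t = scaledCustomers (X n) (b n) (N n) n ω t)
    -- the large deviation principle for the scaled arrival and service processes
    (I : DPath T (EuclideanSpace ℝ (Fin 2)) → ℝ≥0∞)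
    (hLDP : SatisfiesLDP P AS (fun n => b n ^ 2) I)
    (hI : ∀ φ : DPath T (EuclideanSpace ℝ (Fin 2)), ¬ Continuous φ.toFun → I φ = ⊤) :
    SatisfiesLDP P Xs (fun n => b n ^ 2)
      (fun ψ => ⨅ (φ : DPath T (EuclideanSpace ℝ (Fin 2)))
        (_ : IsSkorohodMap hT.le (fun t => x + r * (t : ℝ) + φ t 0 - φ t 1) ψ), I φ) := by
  have hT0 : (0 : ℝ) ≤ T := hT.le
  have hcont : ∀ φ, I φ ≠ ⊤ → Continuous φ.toFun := fun φ h => by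
    by_contra hc
    exact h (hI φ hc)
  -- Individual rates blow up because μⁿ = (N μⁿ/n)/(N/n), with positive limit above and 0⁺ below.
  have hmu_top : Tendsto mu atTop atTop := by
    have h1 : Tendsto (fun n : ℕ => (N n : ℝ) / n) atTop (𝓝[>] 0) := by
      refine tendsto_nhdsWithin_iff.2 ⟨hN, ?_⟩
      filter_upwards [eventually_gt_atTop 0] with n hn
      have := hN_pos n
      exact mem_Ioi.2 (by positivity)
    refine (hmu.pos_mul_atTop hmuLim_pos h1.inv_tendsto_nhdsGT_zero).congr' ?_
    filter_upwards [eventually_gt_atTop 0] with n hn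
    have : (N n : ℝ) ≠ 0 := by exact_mod_cast (hN_pos n).ne'
    have : (n : ℝ) ≠ 0 := by exact_mod_cast hn.ne'
    simp only [Pi.inv_apply]
    field_simp
  have hκ : Tendsto (fun n : ℕ => b n / √(n : ℝ) / (N n * mu n / n)) atTop (𝓝 0) := by
    have := hb'.div hmu hmuLim_pos.ne'
    rwa [zero_div] at this
  let h : DPath T (EuclideanSpace ℝ (Fin 2)) → Icc (0 : ℝ) T → ℝ :=
    fun φ t => x + r * (t : ℝ) + φ t 0 - φ t 1
  have hh : ∀ φ, I φ ≠ ⊤ → Continuous (h φ) := fun φ hφ => by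
    have := hcont φ hφ
    fun_prop
  -- The condition at time 0 passes to limits and gives the limiting input the initial value x ≥ 0,
  -- without which its reflection would not exist.
  let R : ℕ → DPath T (EuclideanSpace ℝ (Fin 2)) → DPath T ℝ → Prop := fun n φ y =>
    φ ⟨0, left_mem_Icc.2 hT0⟩ = 0 ∧
    ∃ (τ : Icc (0 : ℝ) T → Icc (0 : ℝ) T) (L : Icc (0 : ℝ) T → ℝ),
      IsPenalizedReflection hT0 (mu n) (fun t => 1 / (b n * √(n : ℝ)) * ((x₀ n : ℝ) - N n)
        + √(n : ℝ) / b n * (lam n / n - N n * mu n / n) * (t : ℝ) + φ t 0 - φ (τ t) 1) y L ∧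
      ∀ t : Icc (0 : ℝ) T, (t : ℝ) - τ t = b n / √(n : ℝ) / (N n * mu n / n) * L t
  refine hLDP.of_relation R (fun φ ψ => IsSkorohodMap hT0 (h φ) ψ) ?_ ?_ ?_ ?_
  · filter_upwards [hb.eventually_gt_atTop 0, eventually_gt_atTop 0] with n hbn hn
    have hn' : (0 : ℝ) < n := Nat.cast_pos.2 hn
    have hc : 0 < b n * √(n : ℝ) := mul_pos hbn (Real.sqrt_pos.2 hn')
    filter_upwards [hAS n, hXs n, (hX n).rcll, (hX n).dynamics, hS.zero, ae_all_iff.2 hIA.pos]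
      with ω h1 h2 h3 h4 h5 h6
    refine ⟨?_, ?_⟩
    · rw [h1]
      ext i
      fin_cases i
      · simp [scaledArrival, arrivalCount_zero (hlam_pos n) h6]
      · simp [scaledService, h5]
    · obtain ⟨τ, L, hL, hτ⟩ := exists_isPenalizedReflection_of_queue (φ := AS n ω) (y := Xs n ω)
        (A := arrivalCount IA (lam n) ω) (S := fun t => S t ω)
        hT0 h3 (hmu_pos n) (hN_pos n) hc h4 (fun t => by rw [h1]; rfl) (fun t => by rw [h1]; rfl) h2
      have hs : √(n : ℝ) * √(n : ℝ) = n := Real.mul_self_sqrt hn'.le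
      have hs0 : √(n : ℝ) ≠ 0 := (Real.sqrt_pos.2 hn').ne'
      have e1 : √(n : ℝ) / b n * (lam n / n - N n * mu n / n)
          = (lam n - N n * mu n) / (b n * √(n : ℝ)) := by
        rw [← sub_div]
        nth_rewrite 2 [← hs]
        field_simp
      have e2 : b n / √(n : ℝ) / (N n * mu n / n) = b n * √(n : ℝ) / (N n * mu n) := by
        nth_rewrite 2 [← hs]
        field_simp
      refine ⟨τ, L, ?_, ?_⟩
      · rwa [e1]
      · rwa [e2]
  · intro m u v φ hm hR hu hφ
    have hunif := DPath.tendstoUniformly_of_tendsto (hcont φ hφ) hu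
    choose hz τ L hL hτ using hR
    have hφ0 : φ ⟨0, left_mem_Icc.2 hT0⟩ = 0 :=
      tendsto_nhds_unique (hunif.tendsto_at _) (by simp only [hz]; exact tendsto_const_nhds)
    have hin := IsPenalizedReflection.input_tendstoUniformly hL hτ (hx₀.comp hm) (hr.comp hm)
      (hκ.comp hm) (hcont φ hφ) hunif
    refine ⟨?_, fun ψ hψ => DPath.tendsto_of_tendstoUniformly
      (IsPenalizedReflection.tendstoUniformly hL (hmu_top.comp hm) (hh φ hφ) hψ hin)⟩
    obtain ⟨ψ, -, hψ⟩ := exists_isSkorohodMap hT0 (hh φ hφ) (by simpa [h, hφ0] using hx)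
    exact ⟨ψ, hψ⟩
  · intro u v φ hG hu hφ
    have hunif := DPath.tendstoUniformly_of_tendsto (hcont φ hφ) hu
    have hin : TendstoUniformly (fun j => h (u j)) (h φ) atTop := by
      have hg : ∀ i : Fin 2, UniformContinuous fun p : EuclideanSpace ℝ (Fin 2) => p i := fun i =>
        (EuclideanSpace.proj (𝕜 := ℝ) i).uniformContinuous
      have h0 := (hg 0).comp_tendstoUniformly hunif
      have h1 := (hg 1).comp_tendstoUniformly hunif
      have hc : TendstoUniformly (fun (_ : ℕ) (t : Icc (0 : ℝ) T) => x + r * (t : ℝ))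
          (fun t => x + r * (t : ℝ)) atTop := fun s hs =>
        Eventually.of_forall fun _ _ => refl_mem_uniformity hs
      exact (hc.add h0).sub h1
    -- Here φ(0) = 0 is not available; the sign is inherited from the approximating inputs, which do
    -- have reflections.
    have h0 : 0 ≤ h φ ⟨0, left_mem_Icc.2 hT0⟩ := by
      refine ge_of_tendsto' (hin.tendsto_at ⟨0, left_mem_Icc.2 hT0⟩) fun j => ?_
      obtain ⟨K, hK⟩ := hG j
      rw [hK.initial]
      exact hK.nonneg _
    obtain ⟨ψ, -, hψ⟩ := exists_isSkorohodMap hT0 (hh φ hφ) h0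
    exact ⟨ψ, hψ, DPath.tendsto_of_tendstoUniformly (IsSkorohodMap.tendstoUniformly hG hψ hin)⟩
  · intro φ φ' _ hφ' hins
    exact DPath.eq_of_inseparable (hcont φ' hφ') hins
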